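/- Let $X$ be a real Banach space whose norm $\|\cdot\|$ is Fréchet differentiable at every $x\neq 0$, and let $f:X\to\mathbb R\cup\{+\infty\}$ be a convex lower semicontinuous function with $\lim_{\|x\|\to\infty} f(x)/\|x\|=\infty$. Let $(f_\alpha)$ be a net of convex lower semicontinuous functions $f_\alpha:X\to\mathbb R\cup\{+\infty\}$. Write $\operatorname{epi} g=\{(x,t)\in X\times\mathbb R: g(x)\le t\}$, let $Y=X\times\mathbb R$ carry the norm $\|(x,t)\|=(\|x\|^2+|t|^2)^{1/2}$, and for $A,B\subset Y$ put $d(A,B)=\inf\{\|a-b\|:a\in A,\ b\in B\}\in[0,\infty]$ (so that $d(A,B)=\infty$ if $A$ or $B$ is empty) and $d(y,B)=d(\{y\},B)$. Suppose that $\operatorname{epi} f_\alpha$ converges Wijsman to $\operatorname{epi} f$ in $Y$, that is, $\lim_\alpha d(y,\operatorname{epi} f_\alpha)=d(y,\operatorname{epi} f)$ for every $y\in Y$. (a) If $X$ has the Radon–Nikodým property, that is, every nonempty closed bounded convex subset $C$ of $X$ has slices $\{x\in C:\varphi(x)>\sup_C\varphi-\delta\}$ ($\varphi\in X^*$, $\delta>0$)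 of arbitrarily small diameter, then $\operatorname{epi} f_\alpha$ converges slice to $\operatorname{epi} f$ in $Y$, that is, $\lim_\alpha d(W,\operatorname{epi} f_\alpha)=d(W,\operatorname{epi} f)$ for every closed bounded convex set $W\subset Y$. (b) If every level set $\{x\in X: f(x)\le c\}$, $c\in\mathbb R$, is weakly compact, then $\operatorname{epi} f_\alpha$ converges slice to $\operatorname{epi} f$ in $Y$. -/

import Mathlib

namespace SetConvergence

/-- The gap `d(A, B) = inf {‖a - b‖ : a ∈ A, b ∈ B}`, with values in `[0, ∞]`;
it is `∞` if `A` or `B` is empty. -/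
noncomputable def gap {Y : Type*} [PseudoEMetricSpace Y] (A B : Set Y) : ENNReal :=
  ⨅ a ∈ A, ⨅ b ∈ B, edist a b

/-- Wijsman convergence of the family `C i` to `D` along `l`: `d(y, C i) → d(y, D)` in `[0, ∞]`
for every point `y`. -/
def ConvergesWijsman {Y ι : Type*} [PseudoEMetricSpace Y] (l : Filter ι)
    (C : ι → Set Y) (D : Set Y) : Prop :=
  ∀ y : Y, Filter.Tendsto (fun i => gap {y} (C i)) l (nhds (gap {y} D))

/-- Slice convergence of the family `C i` to `D` along `l`: `d(W, C i) → d(W, D)` in `[0, ∞]`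
for every closed bounded convex set `W`. -/
def ConvergesSlice {Y ι : Type*} [NormedAddCommGroup Y] [NormedSpace ℝ Y] (l : Filter ι)
    (C : ι → Set Y) (D : Set Y) : Prop :=
  ∀ W : Set Y, IsClosed W → Bornology.IsBounded W → Convex ℝ W →
    Filter.Tendsto (fun i => gap W (C i)) l (nhds (gap W D))

/-- `f` is a convex lower semicontinuous function with values in `ℝ ∪ {+∞}`
(the constant `+∞` is allowed). -/
structure IsConvexLsc {X : Type*} [NormedAddCommGroup X] [NormedSpace ℝ X]
    (f : X → EReal) : Prop where
  ne_bot : ∀ x, f x ≠ ⊥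
  convex : ∀ x y : X, ∀ a b : ℝ, 0 < a → 0 < b → a + b = 1 →
    f (a • x + b • y) ≤ (a : EReal) * f x + (b : EReal) * f y
  lsc : LowerSemicontinuous f

/-- The epigraph of `f`, as a subset of `X × ℝ` with the `ℓ₂` product norm. -/
def epi {X : Type*} (f : X → EReal) : Set (WithLp 2 (X × ℝ)) :=
  {p | f p.fst ≤ (p.snd : EReal)}

/-- The norm of `X` is Fréchet differentiable (away from the origin). -/
def FrechetDifferentiableNorm (X : Type*) [NormedAddCommGroup X] [NormedSpace ℝ X] : Prop :=
  ∀ x : X, x ≠ 0 → DifferentiableAt ℝ (fun y : X => ‖y‖) x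

/-- The slice `{x ∈ C : φ x > sup_C φ - δ}` of `C` (used for nonempty bounded `C` only). -/
def sliceOf {X : Type*} [NormedAddCommGroup X] [NormedSpace ℝ X] (C : Set X)
    (φ : X →L[ℝ] ℝ) (δ : ℝ) : Set X :=
  {x ∈ C | sSup (φ '' C) - δ < φ x}

/-- The Radon–Nikodým property of a Banach space, in its geometric form: every nonempty closed
bounded convex subset has slices of arbitrarily small diameter. -/
def HasRNP (X : Type*) [NormedAddCommGroup X] [NormedSpace ℝ X] : Prop :=
  ∀ C : Set X, C.Nonempty → IsClosed C → Bornology.IsBounded C → Convex ℝ C →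
    ∀ ε : ℝ, 0 < ε → ∃ φ : X →L[ℝ] ℝ, ∃ δ : ℝ, 0 < δ ∧ Metric.diam (sliceOf C φ δ) < ε

/-- All (sub)level sets `{x : f x ≤ c}`, `c ∈ ℝ`, are compact in the weak topology of `X`. -/
def HasWeaklyCompactLevelSets {X : Type*} [NormedAddCommGroup X] [NormedSpace ℝ X]
    (f : X → EReal) : Prop :=
  ∀ c : ℝ, IsCompact (toWeakSpace ℝ X '' {x : X | f x ≤ (c : EReal)})

end SetConvergence

/-!
# From Wijsman to slice convergence of epigraphs

Upper estimates for `d(W, epi F i)` are immediate. For the lower one, separate a bounded convex `W`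
from `epi f` by a functional `Λ` on `X × ℝ`. If `Λ` attains its minimum over `epi f` at `c` and its
norm at `v`, then `c` is the nearest point of `epi f` to `c - v`. Since the `ℓ₂` norm is Fréchet
differentiable at `v`, the distances of `c` and `c - v` to the convex sets `epi F i` alone force
`Λ ≥ Λ c - ε` eventually on any bounded part of `epi F i`
(`ConvergesWijsman.eventually_sub_le`), and only a bounded part matters because `W` is bounded.

It remains to perturb `Λ` to such a functional. Adding a small multiple of the height makes `Λ` a
positive multiple of a tilt `(x, t) ↦ t + ψ x`; superlinear growth of `f` shows that changing `ψ`
slightly hardly lowers the infimum over `epi f` (`ConvergesWijsman.convergesSlice`). So it suffices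
that densely many `ψ` attain their norm and make `f + ψ` attain its minimum.

* If the level sets of `f` are weakly compact, every `ψ` satisfies the second condition, and the
  first one is the Bishop–Phelps theorem (`dense_norm_attaining`).
* If `X` has the Radon–Nikodým property, Stegall's variational principle gives each condition on a
  dense `Gδ` set (`HasRNP.dense_attain`). Density is obtained by dentability of the set of all
  minimisers of `f + ψ`, for `ψ` in a given ball (`dense_smallNearMin`); this uses the property in
  `X` only, so that it need not be transferred to `X × ℝ`.

Both rest on the Brøndsted–Rockafellar theorem (`exists_nearMin_zero`), which follows from
Ekeland's variational principle and the Hahn–Banach theorem.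
-/

open Filter Topology Set

namespace SetConvergence

variable {X : Type*} [NormedAddCommGroup X] [NormedSpace ℝ X]

/-! ### Tilts and their near-minimisers -/

/-- The affine tilt `(x, t) ↦ t + ψ x`. Minimising it over `epi f` is minimising `f + ψ`, but all
values stay real. -/
def tilt (ψ : X →L[ℝ] ℝ) (p : WithLp 2 (X × ℝ)) : ℝ := p.snd + ψ p.fst

/-- The points of `E` at which `(x, t) ↦ t + ψ x` is within `δ` of its infimum over `E`; for
`δ = 0` these are the minimisers. -/
def nearMin (E : Set (WithLp 2 (X × ℝ))) (ψ : X →L[ℝ] ℝ) (δ : ℝ) : Set (WithLp 2 (X × ℝ)) :=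
  {p ∈ E | ∀ q ∈ E, tilt ψ p ≤ tilt ψ q + δ}

/-- Superlinear growth of the second coordinate over `E`: for `E = epi f` this says that `f` is
bounded below and `f x / ‖x‖ → ∞`. -/
def Coercive {X : Type*} [NormedAddCommGroup X] (E : Set (WithLp 2 (X × ℝ))) : Prop :=
  ∀ K : ℝ, ∃ C : ℝ, ∀ p ∈ E, K * ‖p.fst‖ - C ≤ p.snd

theorem continuous_tilt (ψ : X →L[ℝ] ℝ) : Continuous (tilt ψ) := by
  unfold tilt
  fun_prop

theorem nearMin_mono {E : Set (WithLp 2 (X × ℝ))} {ψ : X →L[ℝ] ℝ} {δ δ' : ℝ} (h : δ ≤ δ') :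
    nearMin E ψ δ ⊆ nearMin E ψ δ' :=
  fun _ hp => ⟨hp.1, fun q hq => (hp.2 q hq).trans (by linarith)⟩

theorem exists_le_add_of_bddBelow {α : Type*} {A : Set α} (hA : A.Nonempty) {h : α → ℝ} {m : ℝ}
    (hm : ∀ a ∈ A, m ≤ h a) {δ : ℝ} (hδ : 0 < δ) : ∃ a ∈ A, ∀ r ∈ A, h a ≤ h r + δ := by
  have hbdd : BddBelow (h '' A) := ⟨m, by rintro _ ⟨a, ha, rfl⟩; exact hm a ha⟩
  obtain ⟨_, ⟨a, ha, rfl⟩, hlt⟩ :=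
    exists_lt_of_csInf_lt (hA.image h) (lt_add_of_pos_right (sInf (h '' A)) hδ)
  refine ⟨a, ha, fun r hr => ?_⟩
  have := csInf_le hbdd (mem_image_of_mem h hr)
  linarith

theorem norm_le_norm_fst_add {X : Type*} [NormedAddCommGroup X] (p : WithLp 2 (X × ℝ)) :
    ‖p‖ ≤ ‖p.fst‖ + |p.snd| := by
  rw [WithLp.prod_norm_eq_of_L2, Real.sqrt_le_left (by positivity), Real.norm_eq_abs]
  nlinarith [norm_nonneg p.fst, abs_nonneg p.snd]

theorem dist_le_tilt (ψ : X →L[ℝ] ℝ) (p q : WithLp 2 (X × ℝ)) :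
    dist p q ≤ (1 + ‖ψ‖) * ‖p.fst - q.fst‖ + |tilt ψ p - tilt ψ q| := by
  have h1 := norm_le_norm_fst_add (p - q)
  rw [WithLp.sub_fst, WithLp.sub_snd] at h1
  have h2 := ψ.le_opNorm (p.fst - q.fst)
  have h3 : p.snd - q.snd = (tilt ψ p - tilt ψ q) - ψ (p.fst - q.fst) := by
    simp only [tilt, map_sub]; ring
  have h4 := abs_sub (tilt ψ p - tilt ψ q) (ψ (p.fst - q.fst))
  rw [← h3] at h4
  rw [Real.norm_eq_abs] at h2
  rw [dist_eq_norm]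
  linarith

/-! ### Ekeland's principle and the Brøndsted–Rockafellar theorem -/

/-- Ekeland's variational principle for a tilt on a closed set, with perturbation `b ‖x - x'‖`
in the first coordinate only. -/
theorem exists_ekeland [CompleteSpace X] {E : Set (WithLp 2 (X × ℝ))} (hE : IsClosed E)
    (ψ : X →L[ℝ] ℝ) {m : ℝ} (hm : ∀ q ∈ E, m ≤ tilt ψ q) {b : ℝ} (hb : 0 < b)
    {p : WithLp 2 (X × ℝ)} (hp : p ∈ E) :
    ∃ p' ∈ E, tilt ψ p' + b * ‖p'.fst - p.fst‖ ≤ tilt ψ p ∧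
      ∀ q ∈ E, tilt ψ p' ≤ tilt ψ q + b * ‖q.fst - p'.fst‖ := by
  let S : WithLp 2 (X × ℝ) → Set (WithLp 2 (X × ℝ)) :=
    fun p => {q ∈ E | tilt ψ q + b * ‖q.fst - p.fst‖ ≤ tilt ψ p}
  have hSself : ∀ p ∈ E, p ∈ S p := fun p hp => ⟨hp, by simp⟩
  have hStrans : ∀ {p q r}, q ∈ S p → r ∈ S q → r ∈ S p := by
    rintro p q r ⟨-, hq⟩ ⟨hr, hrq⟩
    refine ⟨hr, ?_⟩
    have := norm_sub_le_norm_sub_add_norm_sub r.fst q.fst p.fst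
    nlinarith
  have hSclosed : ∀ p, IsClosed (S p) := fun p => hE.inter (isClosed_le
    ((continuous_tilt ψ).add (by fun_prop)) continuous_const)
  have step : ∀ (p : E) (n : ℕ), ∃ q : E, q.1 ∈ S p.1 ∧
      ∀ r ∈ S p.1, tilt ψ q.1 ≤ tilt ψ r + 1 / ((n : ℝ) + 1) := by
    intro p n
    obtain ⟨q, hq, h⟩ := exists_le_add_of_bddBelow ⟨p.1, hSself p.1 p.2⟩
      (fun a (ha : a ∈ S p.1) => hm a ha.1) (δ := 1 / ((n : ℝ) + 1)) (by positivity)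
    exact ⟨⟨q, hq.1⟩, hq, h⟩
  choose g hgS hg using step
  obtain ⟨u, hu0, hu⟩ : ∃ u : ℕ → E, u 0 = ⟨p, hp⟩ ∧ ∀ n, u (n + 1) = g (u n) n :=
    ⟨fun n => Nat.rec ⟨p, hp⟩ (fun n q => g q n) n, rfl, fun n => rfl⟩
  have hanti : ∀ n k, (u (n + k)).1 ∈ S (u n).1 := by
    intro n k
    induction k with
    | zero => exact hSself _ (u n).2
    | succ k ih => exact hStrans ih (hu (n + k) ▸ hgS _ _)
  set K : ℝ := (1 + ‖ψ‖) / b + 1 with hK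
  have hKpos : 0 < K := by positivity
  -- A near-minimiser of the tilt on `S (u n)` confines all its own successors to a small ball.
  have hclose : ∀ n, ∀ r ∈ S (u (n + 1)).1, dist r (u (n + 1)).1 ≤ K * (1 / ((n : ℝ) + 1)) := by
    intro n r hr
    have h1 := hg (u n) n r (hStrans (hanti n 1) hr)
    rw [← hu] at h1
    have h2 := hr.2
    have h3 := dist_le_tilt ψ r (u (n + 1)).1
    set d := ‖r.fst - (u (n + 1)).1.fst‖
    have hd : 0 ≤ d := norm_nonneg _
    have hbd : b * d ≤ 1 / ((n : ℝ) + 1) := by linarith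
    have habs : |tilt ψ r - tilt ψ (u (n + 1)).1| ≤ 1 / ((n : ℝ) + 1) := by
      rw [abs_le]; constructor <;> nlinarith
    have h5 : (1 + ‖ψ‖) * d ≤ (1 + ‖ψ‖) / b * (1 / ((n : ℝ) + 1)) := by
      rw [div_mul_eq_mul_div, le_div_iff₀ hb, mul_assoc]
      exact mul_le_mul_of_nonneg_left (by linarith) (by positivity)
    rw [hK]; linarith
  have hlim0 : Tendsto (fun n : ℕ => K * (1 / ((n : ℝ) + 1))) atTop (𝓝 0) := by
    simpa using tendsto_one_div_add_atTop_nhds_zero_nat.const_mul K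
  have hmem : ∀ n m, n ≤ m → (u m).1 ∈ S (u n).1 := by
    intro n m h
    obtain ⟨k, rfl⟩ := Nat.exists_eq_add_of_le h
    exact hanti n k
  have hcauchy : CauchySeq fun n => (u (n + 1)).1 := by
    refine cauchySeq_of_le_tendsto_0' (fun n : ℕ => K * (1 / ((n : ℝ) + 1))) ?_ hlim0
    intro n m hnm
    rw [dist_comm]
    exact hclose n _ (hmem (n + 1) (m + 1) (by omega))
  obtain ⟨p', hp'⟩ := cauchySeq_tendsto_of_complete hcauchy
  have hp'S : ∀ n, p' ∈ S (u n).1 := fun n =>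
    (hSclosed _).mem_of_tendsto hp' (eventually_atTop.2
      ⟨n, fun m hm => hmem n (m + 1) (Nat.le_succ_of_le hm)⟩)
  have h0 := (hp'S 0).2
  rw [hu0] at h0
  refine ⟨p', (hp'S 0).1, h0, fun q hq => ?_⟩
  by_contra! hlt
  have hqS : q ∈ S p' := ⟨hq, hlt.le⟩
  have hqlim : Tendsto (fun n => (u (n + 1)).1) atTop (𝓝 q) := by
    rw [tendsto_iff_dist_tendsto_zero]
    refine squeeze_zero (fun _ => dist_nonneg) (fun n => ?_) hlim0
    rw [dist_comm]
    exact hclose n q (hStrans (hp'S _) hqS)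
  have := tendsto_nhds_unique hqlim hp'
  subst this
  simp at hlt

/-- The Brøndsted–Rockafellar theorem: near a near-minimiser of a tilt over a closed convex set
there is an exact minimiser of a nearby tilt. Only first coordinates are compared. -/
theorem exists_nearMin_zero [CompleteSpace X] {E : Set (WithLp 2 (X × ℝ))} (hE : IsClosed E)
    (hconv : Convex ℝ E) (ψ : X →L[ℝ] ℝ) {a : ℝ} (ha : 0 < a)
    {p : WithLp 2 (X × ℝ)} (hp : p ∈ nearMin E ψ (a * a)) :
    ∃ ψ' : X →L[ℝ] ℝ, ‖ψ' - ψ‖ ≤ a ∧ ∃ p' ∈ nearMin E ψ' 0, ‖p'.fst - p.fst‖ ≤ a := by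
  obtain ⟨p', hp'E, hp'p, hmin⟩ := exists_ekeland hE ψ (m := tilt ψ p - a * a)
    (fun q hq => by linarith [hp.2 q hq]) ha hp.1
  -- Separate the open cone `s < -a ‖x‖` from the graph of the tilt, both based at `p'`.
  let A : Set (X × ℝ) := {z | z.2 < -a * ‖z.1‖}
  let B : Set (X × ℝ) := (fun q : WithLp 2 (X × ℝ) => (q.fst - p'.fst, tilt ψ q - tilt ψ p')) '' E
  have hA : Convex ℝ A := by
    rintro ⟨x, s⟩ hx ⟨y, t⟩ hy α β hα hβ hαβ
    simp only [A, mem_ofPred_eq, Prod.smul_mk, Prod.mk_add_mk, smul_eq_mul] at hx hy ⊢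
    have h1 : ‖α • x + β • y‖ ≤ α * ‖x‖ + β * ‖y‖ := by
      refine (norm_add_le _ _).trans ?_
      rw [norm_smul, norm_smul, Real.norm_of_nonneg hα, Real.norm_of_nonneg hβ]
    have h2 : a * ‖α • x + β • y‖ ≤ a * (α * ‖x‖ + β * ‖y‖) :=
      mul_le_mul_of_nonneg_left h1 ha.le
    rcases hα.eq_or_lt with rfl | hα'
    · obtain rfl : β = 1 := by linarith
      nlinarith
    · nlinarith
  have hAo : IsOpen A := isOpen_lt (by fun_prop) (by fun_prop)
  have hB : Convex ℝ B := by
    rintro _ ⟨q, hq, rfl⟩ _ ⟨r, hr, rfl⟩ α β hα hβ hαβ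
    refine ⟨α • q + β • r, hconv hq hr hα hβ hαβ, ?_⟩
    obtain rfl : β = 1 - α := by linarith
    simp only [tilt, WithLp.add_fst, WithLp.smul_fst, WithLp.add_snd, WithLp.smul_snd,
      Prod.smul_mk, Prod.mk_add_mk, smul_eq_mul, map_add, map_smul, Prod.mk.injEq]
    constructor
    · module
    · ring
  have hdisj : Disjoint A B := by
    rw [Set.disjoint_left]
    rintro _ hz ⟨q, hq, rfl⟩
    simp only [A, mem_ofPred_eq] at hz
    have := hmin q hq
    linarith
  obtain ⟨F, u, hFA, hFB⟩ := geometric_hahn_banach_open hA hAo hB hdisj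
  have hsplit : ∀ (x : X) (s : ℝ), F (x, s) = F (x, 0) + s * F (0, 1) := by
    intro x s
    rw [← smul_eq_mul, ← map_smul, ← map_add]
    simp
  set κ := F (0, 1) with hκdef
  have hu0 : u ≤ 0 := by
    have := hFB (0, 0) ⟨p', hp'E, by simp⟩
    rwa [Prod.mk_zero_zero, map_zero] at this
  have hκ : 0 < κ := by
    have := hFA (0, -1) (by simp [A])
    rw [hsplit, Prod.mk_zero_zero, map_zero] at this
    linarith
  have hu : 0 ≤ u := by
    by_contra! hneg
    have := hFA (0, u / κ) (by simp only [A, mem_ofPred_eq, norm_zero, mul_zero]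
                               exact div_neg_of_neg_of_pos hneg hκ)
    rw [hsplit, Prod.mk_zero_zero, map_zero, div_mul_cancel₀ _ hκ.ne'] at this
    linarith
  let θ : X →L[ℝ] ℝ := κ⁻¹ • F.comp (ContinuousLinearMap.inl ℝ X ℝ)
  have hθ : ∀ x, κ * θ x = F (x, 0) := by
    intro x
    simp [θ, mul_inv_cancel_left₀ hκ.ne']
  have hθle : ∀ x, θ x ≤ a * ‖x‖ := by
    intro x
    refine le_of_forall_pos_lt_add fun ε hε => ?_
    have := hFA (x, -a * ‖x‖ - ε) (by simp only [A, mem_ofPred_eq]; linarith)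
    rw [hsplit, ← hθ] at this
    have h2 : κ * (θ x + (-a * ‖x‖ - ε)) < κ * 0 := by linarith
    linarith [lt_of_mul_lt_mul_left h2 hκ.le]
  refine ⟨ψ + θ, ?_, p', ⟨hp'E, fun q hq => ?_⟩, ?_⟩
  · rw [add_sub_cancel_left]
    refine θ.opNorm_le_bound ha.le fun x => abs_le.2 ⟨?_, hθle x⟩
    have := hθle (-x)
    rw [map_neg, norm_neg] at this
    linarith
  · have := hFB _ ⟨q, hq, rfl⟩
    simp only at this
    rw [hsplit, ← hθ] at this
    have h2 : κ * 0 ≤ κ * (θ (q.fst - p'.fst) + (tilt ψ q - tilt ψ p')) := by linarith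
    have h3 := le_of_mul_le_mul_left h2 hκ
    simp only [tilt, map_sub, add_apply] at h3 ⊢
    linarith
  · have := hp.2 p' hp'E
    exact le_of_mul_le_mul_left (by linarith) ha

/-! ### Stegall's variational principle -/

theorem Coercive.exists_le_tilt {E : Set (WithLp 2 (X × ℝ))} (hE : Coercive E) (ψ : X →L[ℝ] ℝ) :
    ∃ m, ∀ q ∈ E, m ≤ tilt ψ q := by
  obtain ⟨C, hC⟩ := hE ‖ψ‖
  refine ⟨-C, fun q hq => ?_⟩
  have h1 := hC q hq
  have h2 := (abs_le.1 (ψ.le_opNorm q.fst)).1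
  simp only [tilt]
  linarith

theorem Coercive.nearMin_nonempty {E : Set (WithLp 2 (X × ℝ))} (hE : Coercive E)
    (hne : E.Nonempty) (ψ : X →L[ℝ] ℝ) {δ : ℝ} (hδ : 0 < δ) : (nearMin E ψ δ).Nonempty := by
  obtain ⟨m, hm⟩ := hE.exists_le_tilt ψ
  obtain ⟨a, ha, h⟩ := exists_le_add_of_bddBelow hne hm hδ
  exact ⟨a, ha, h⟩

theorem Coercive.exists_norm_fst_le {E : Set (WithLp 2 (X × ℝ))} (hE : Coercive E)
    (hne : E.Nonempty) (K : ℝ) :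
    ∃ R, 0 < R ∧ ∀ ψ : X →L[ℝ] ℝ, ‖ψ‖ ≤ K → ∀ p ∈ nearMin E ψ 1, ‖p.fst‖ ≤ R := by
  obtain ⟨C, hC⟩ := hE (K + 1)
  obtain ⟨q, hq⟩ := hne
  refine ⟨max 1 (C + q.snd + K * ‖q.fst‖ + 1), by positivity, fun ψ hψ p hp => ?_⟩
  refine le_max_of_le_right ?_
  have h1 := hC p hp.1
  have h2 := hp.2 q hq
  have h3 := (abs_le.1 (ψ.le_of_opNorm_le hψ p.fst)).1
  have h4 := (abs_le.1 (ψ.le_of_opNorm_le hψ q.fst)).2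
  simp only [tilt] at h2
  linarith

/-- The functionals `ψ` whose near-minimisers over `E` have first coordinates within `ε` of each
other. -/
def smallNearMin (E : Set (WithLp 2 (X × ℝ))) (ε : ℝ) : Set (X →L[ℝ] ℝ) :=
  {ψ | ∃ δ > 0, ∀ p ∈ nearMin E ψ δ, ∀ q ∈ nearMin E ψ δ, dist p.fst q.fst ≤ ε}

theorem isOpen_smallNearMin {E : Set (WithLp 2 (X × ℝ))} (hE : Coercive E)
    (hne : E.Nonempty) (ε : ℝ) : IsOpen (smallNearMin E ε) := by
  rw [Metric.isOpen_iff]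
  rintro ψ ⟨δ, hδ, hsmall⟩
  obtain ⟨R, hR, hbd⟩ := hE.exists_norm_fst_le hne (‖ψ‖ + 1)
  set δ' := min 1 (δ / 4) with hδ'
  have hδ'pos : 0 < δ' := by positivity
  obtain ⟨q₀, hq₀⟩ := hE.nearMin_nonempty hne ψ hδ'pos
  have hq₀R : ‖q₀.fst‖ ≤ R := hbd ψ (by linarith) q₀ (nearMin_mono (min_le_left _ _) hq₀)
  refine ⟨min 1 (δ / (4 * R)), by positivity, fun χ hχ => ?_⟩
  rw [Metric.mem_ball, dist_eq_norm, lt_min_iff] at hχ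
  have hχn : ‖χ‖ ≤ ‖ψ‖ + 1 := by
    have := norm_le_norm_add_norm_sub ψ χ
    rw [norm_sub_rev] at this
    linarith
  have hχR : ‖χ - ψ‖ * R ≤ δ / 4 := by
    have := mul_le_mul_of_nonneg_right hχ.2.le hR.le
    rwa [div_mul_eq_mul_div, mul_div_mul_right _ _ hR.ne'] at this
  have hdiff : ∀ x : X, ‖x‖ ≤ R → |χ x - ψ x| ≤ δ / 4 := by
    intro x hx
    have := (χ - ψ).le_opNorm x
    rw [sub_apply, Real.norm_eq_abs] at this
    exact this.trans ((mul_le_mul_of_nonneg_left hx (norm_nonneg _)).trans hχR)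
  -- Near-minimisers for `χ` and `ψ` all lie in the ball of radius `R`, where `χ` is close to `ψ`.
  have hsub : nearMin E χ δ' ⊆ nearMin E ψ δ := by
    intro y hy
    refine ⟨hy.1, fun q hq => ?_⟩
    have hyR := abs_le.1 (hdiff y.fst (hbd χ hχn y (nearMin_mono (min_le_left _ _) hy)))
    have hqR := abs_le.1 (hdiff q₀.fst hq₀R)
    have h1 := hy.2 q₀ hq₀.1
    have h2 := hq₀.2 q hq
    have h3 : δ' ≤ δ / 4 := min_le_right _ _
    simp only [tilt] at h1 h2 ⊢
    linarith
  exact ⟨δ', hδ'pos, fun p hp q hq => hsmall p (hsub hp) q (hsub hq)⟩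

/-- In a space with the Radon–Nikodým property, the functionals with small near-minimiser sets are
dense. All exact minimisers for functionals `ψ` in a ball form a bounded set, whose closed convex
hull has a small slice, cut out by some `φ`. Moving from `ψ` to `ψ - r φ` pushes the minimisers
upwards along `φ` (monotonicity of the subdifferential), hence into that slice. -/
theorem dense_smallNearMin [CompleteSpace X] (hX : HasRNP X) {E : Set (WithLp 2 (X × ℝ))}
    (hcl : IsClosed E) (hconv : Convex ℝ E) (hE : Coercive E) (hne : E.Nonempty)
    {ε : ℝ} (hε : 0 < ε) : Dense (smallNearMin E ε) := by
  rw [Metric.dense_iff]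
  intro ψ₀ ρ hρ
  obtain ⟨R, hR, hbd⟩ := hE.exists_norm_fst_le hne (‖ψ₀‖ + ρ)
  let A : Set X := {x | ∃ ψ ∈ Metric.ball ψ₀ ρ, ∃ p ∈ nearMin E ψ 0, p.fst = x}
  have hAR : A ⊆ Metric.closedBall 0 R := by
    rintro _ ⟨ψ, hψ, p, hp, rfl⟩
    rw [mem_closedBall_zero_iff]
    refine hbd ψ ?_ p (nearMin_mono zero_le_one hp)
    rw [mem_ball_iff_norm] at hψ
    have := norm_le_norm_add_norm_sub ψ₀ ψ
    rw [norm_sub_rev] at this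
    linarith
  have hAne : A.Nonempty := by
    have hρ2 : 0 < ρ / 2 := by positivity
    obtain ⟨p, hp⟩ := hE.nearMin_nonempty hne ψ₀ (mul_pos hρ2 hρ2)
    obtain ⟨ψ, hψ, p', hp', -⟩ := exists_nearMin_zero hcl hconv ψ₀ hρ2 hp
    exact ⟨p'.fst, ψ, by rw [mem_ball_iff_norm]; linarith, p', hp', rfl⟩
  let D := closedConvexHull ℝ A
  have hAD : A ⊆ D := subset_closedConvexHull
  have hDR : D ⊆ Metric.closedBall 0 R :=
    closedConvexHull_min hAR (convex_closedBall _ _) Metric.isClosed_closedBall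
  have hDbd : Bornology.IsBounded D := Metric.isBounded_closedBall.subset hDR
  obtain ⟨φ, α, hα, hdiam⟩ := hX D (hAne.mono hAD) isClosed_closedConvexHull hDbd
    convex_closedConvexHull (ε / 2) (by positivity)
  set σ := sSup (φ '' D) with hσ
  -- A half-space containing `A` contains `D`, so the slice meets `A`.
  obtain ⟨x, hxA, hx⟩ : ∃ x ∈ A, σ - α < φ x := by
    by_contra! hall
    have hD : D ⊆ {x | φ x ≤ σ - α} := closedConvexHull_min hall
      (convex_halfSpace_le φ.isLinear _) (isClosed_le φ.continuous continuous_const)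
    have : σ ≤ σ - α := csSup_le ((hAne.mono hAD).image _) (by rintro _ ⟨d, hd, rfl⟩; exact hD hd)
    linarith
  obtain ⟨ψ, hψ, p, hp, rfl⟩ := hxA
  set β := φ p.fst - (σ - α) with hβ
  have hβpos : 0 < β := by linarith
  set γ := ρ - ‖ψ - ψ₀‖ with hγ
  have hγpos : 0 < γ := by
    rw [mem_ball_iff_norm] at hψ; linarith
  -- This `r` keeps `ψ - r φ` at distance at most `ρ - γ / 2` from `ψ₀`.
  set r := γ / (2 * (‖φ‖ + 1)) with hr
  have hrpos : 0 < r := by positivity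
  have hrφ : r * ‖φ‖ ≤ γ / 2 := by
    rw [hr, div_mul_eq_mul_div, div_le_div_iff₀ (by positivity) (by positivity)]
    nlinarith [norm_nonneg φ]
  obtain ⟨a, ha, haγ, haε, ha1, haβ⟩ : ∃ a > 0, a < γ / 2 ∧ a ≤ ε / 4 ∧ a ≤ 1 ∧
      a * (1 / r + ‖φ‖) < β := by
    refine ⟨min (min (γ / 4) (ε / 4)) (min 1 (β / (2 * (1 / r + ‖φ‖)))), by positivity, ?_, ?_, ?_,
      ?_⟩
    · exact ((min_le_left _ _).trans (min_le_left _ _)).trans_lt (by linarith)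
    · exact (min_le_left _ _).trans (min_le_right _ _)
    · exact (min_le_right _ _).trans (min_le_left _ _)
    · have hpos : 0 < 1 / r + ‖φ‖ := by positivity
      refine (mul_le_mul_of_nonneg_right ((min_le_right _ _).trans (min_le_right _ _))
        hpos.le).trans_lt ?_
      rw [div_mul_eq_mul_div, mul_div_mul_right _ _ hpos.ne']
      linarith
  have hψ₁ : ‖ψ - r • φ - ψ₀‖ ≤ ‖ψ - ψ₀‖ + γ / 2 := by
    have h1 : ψ - r • φ - ψ₀ = (ψ - ψ₀) - r • φ := by abel
    rw [h1]
    refine (norm_sub_le _ _).trans ?_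
    rw [norm_smul, Real.norm_of_nonneg hrpos.le]
    linarith
  -- Comparing the minimality of `p` for `ψ` with the near-minimality of `y` for `ψ - r φ` gives
  -- `φ p.fst - a² / r ≤ φ y.fst`; an exact minimiser near `y` is then in `A` and in the slice.
  have key : ∀ y ∈ nearMin E (ψ - r • φ) (a * a), ∃ z ∈ sliceOf D φ α, dist y.fst z ≤ a := by
    intro y hy
    obtain ⟨ψ', hψ', y', hy', hyy'⟩ := exists_nearMin_zero hcl hconv _ ha hy
    have hball : ψ' ∈ Metric.ball ψ₀ ρ := by
      rw [mem_ball_iff_norm]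
      have := norm_sub_le_norm_sub_add_norm_sub ψ' (ψ - r • φ) ψ₀
      linarith
    refine ⟨y'.fst, ⟨hAD ⟨ψ', hball, y', hy', rfl⟩, ?_⟩, by rwa [dist_comm, dist_eq_norm]⟩
    have h1 := hy.2 p hp.1
    have h2 := hp.2 y hy.1
    simp only [tilt, sub_apply, smul_apply, smul_eq_mul] at h1 h2
    have h3 : r * φ p.fst ≤ r * (φ y.fst + a * a / r) := by
      rw [mul_add, mul_div_cancel₀ _ hrpos.ne']; linarith
    have h4 := le_of_mul_le_mul_left h3 hrpos
    have h5 := (abs_le.1 (φ.le_opNorm (y'.fst - y.fst))).1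
    have h6 : ‖φ‖ * ‖y'.fst - y.fst‖ ≤ ‖φ‖ * a := mul_le_mul_of_nonneg_left hyy' (norm_nonneg _)
    rw [map_sub] at h5
    have h7 : a * a / r ≤ a * (1 / r) := by
      rw [mul_one_div]
      exact div_le_div_of_nonneg_right (by nlinarith) hrpos.le
    rw [← hσ]
    linarith
  refine ⟨ψ - r • φ, ?_, a * a, mul_pos ha ha, fun y hy z hz => ?_⟩
  · rw [mem_ball_iff_norm]; linarith
  · obtain ⟨y', hy', hyd⟩ := key y hy
    obtain ⟨z', hz', hzd⟩ := key z hz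
    have h1 : dist y' z' ≤ Metric.diam (sliceOf D φ α) :=
      Metric.dist_le_diam_of_mem (hDbd.subset fun _ h => h.1) hy' hz'
    have h2 := dist_triangle4_right y.fst z.fst y' z'
    linarith

/-- If all near-minimiser sets shrink, the minimum is attained. -/
theorem exists_nearMin_zero_of_small [CompleteSpace X] {E : Set (WithLp 2 (X × ℝ))}
    (hcl : IsClosed E) (hE : Coercive E) (hne : E.Nonempty) {ψ : X →L[ℝ] ℝ}
    (hψ : ∀ n : ℕ, ψ ∈ smallNearMin E (1 / ((n : ℝ) + 1))) : (nearMin E ψ 0).Nonempty := by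
  have h0 := tendsto_one_div_add_atTop_nhds_zero_nat (𝕜 := ℝ)
  choose y hy using fun n : ℕ =>
    hE.nearMin_nonempty hne ψ (δ := 1 / ((n : ℝ) + 1)) (by positivity)
  have hcauchy : CauchySeq y := by
    rw [Metric.cauchySeq_iff']
    intro ε hε
    obtain ⟨n, hn⟩ := exists_nat_one_div_lt (show 0 < ε / (2 * (1 + ‖ψ‖)) by positivity)
    obtain ⟨δ, hδ, hsmall⟩ := hψ n
    obtain ⟨N, hN⟩ := exists_nat_one_div_lt (show 0 < min δ (ε / 2) by positivity)
    refine ⟨N, fun m hm => ?_⟩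
    have hmN : 1 / ((m : ℝ) + 1) ≤ 1 / ((N : ℝ) + 1) := Nat.one_div_le_one_div hm
    have hNδ : 1 / ((N : ℝ) + 1) < δ := hN.trans_le (min_le_left _ _)
    have hNε : 1 / ((N : ℝ) + 1) < ε / 2 := hN.trans_le (min_le_right _ _)
    have h1 := hsmall _ (nearMin_mono (hmN.trans hNδ.le) (hy m)) _ (nearMin_mono hNδ.le (hy N))
    rw [dist_eq_norm] at h1
    have h2 := dist_le_tilt ψ (y m) (y N)
    have h3 : |tilt ψ (y m) - tilt ψ (y N)| < ε / 2 := by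
      rw [abs_lt]
      constructor <;> linarith [(hy m).2 _ (hy N).1, (hy N).2 _ (hy m).1]
    have h4 : (1 + ‖ψ‖) * ‖(y m).fst - (y N).fst‖ ≤ ε / 2 := by
      have := mul_le_mul_of_nonneg_left (h1.trans hn.le) (show 0 ≤ 1 + ‖ψ‖ by positivity)
      refine this.trans (le_of_eq ?_)
      field_simp
    linarith
  obtain ⟨p, hp⟩ := cauchySeq_tendsto_of_complete hcauchy
  refine ⟨p, hcl.mem_of_tendsto hp (Eventually.of_forall fun n => (hy n).1), fun q hq => ?_⟩
  refine le_of_tendsto_of_tendsto (((continuous_tilt ψ).tendsto p).comp hp)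
    (h0.const_add (tilt ψ q)) (Eventually.of_forall fun n => (hy n).2 q hq)

/-- Stegall's variational principle for two sets at once: by Baire's theorem, densely many
functionals attain their minimum over both. -/
theorem HasRNP.dense_attain [CompleteSpace X] (hX : HasRNP X) {E E' : Set (WithLp 2 (X × ℝ))}
    (hcl : IsClosed E) (hconv : Convex ℝ E) (hE : Coercive E) (hne : E.Nonempty)
    (hcl' : IsClosed E') (hconv' : Convex ℝ E') (hE' : Coercive E') (hne' : E'.Nonempty) :
    Dense {ψ : X →L[ℝ] ℝ | (nearMin E ψ 0).Nonempty ∧ (nearMin E' ψ 0).Nonempty} := by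
  have hpos : ∀ n : ℕ, (0 : ℝ) < 1 / ((n : ℝ) + 1) := fun n => by positivity
  have hdense : Dense (⋂ n : ℕ, smallNearMin E (1 / ((n : ℝ) + 1)) ∩
      smallNearMin E' (1 / ((n : ℝ) + 1))) :=
    dense_iInter_of_isOpen
      (fun n => (isOpen_smallNearMin hE hne _).inter (isOpen_smallNearMin hE' hne' _))
      (fun n => (dense_smallNearMin hX hcl hconv hE hne (hpos n)).inter_of_isOpen_left
        (dense_smallNearMin hX hcl' hconv' hE' hne' (hpos n)) (isOpen_smallNearMin hE hne _))
  refine hdense.mono fun ψ hψ => ?_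
  rw [mem_iInter] at hψ
  exact ⟨exists_nearMin_zero_of_small hcl hE hne fun n => (hψ n).1,
    exists_nearMin_zero_of_small hcl' hE' hne' fun n => (hψ n).2⟩

/-! ### Epigraphs -/

theorem IsConvexLsc.isClosed_epi {f : X → EReal} (hf : IsConvexLsc f) : IsClosed (epi f) := by
  have h : Continuous fun p : WithLp 2 (X × ℝ) => (p.fst, ((p.snd : ℝ) : EReal)) :=
    (by fun_prop : Continuous fun p : WithLp 2 (X × ℝ) => p.fst).prodMk
      (continuous_coe_real_ereal.comp (by fun_prop))
  exact hf.lsc.isClosed_epigraph.preimage h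

theorem IsConvexLsc.convex_epi {f : X → EReal} (hf : IsConvexLsc f) : Convex ℝ (epi f) := by
  rw [convex_iff_forall_pos]
  intro p hp q hq a b ha hb hab
  change f _ ≤ _
  rw [WithLp.add_fst, WithLp.smul_fst, WithLp.smul_fst, WithLp.add_snd, WithLp.smul_snd,
    WithLp.smul_snd, smul_eq_mul, smul_eq_mul, EReal.coe_add, EReal.coe_mul, EReal.coe_mul]
  refine (hf.convex _ _ a b ha hb hab).trans (add_le_add ?_ ?_)
  · exact mul_le_mul_of_nonneg_left hp (EReal.coe_nonneg.2 ha.le)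
  · exact mul_le_mul_of_nonneg_left hq (EReal.coe_nonneg.2 hb.le)

theorem mem_epi_of_le {X : Type*} {f : X → EReal} {p : WithLp 2 (X × ℝ)} (hp : p ∈ epi f) {t : ℝ}
    (ht : p.snd ≤ t) : WithLp.toLp 2 (p.fst, t) ∈ epi f :=
  le_trans (show f p.fst ≤ (p.snd : EReal) from hp) (EReal.coe_le_coe_iff.2 ht)

theorem exists_split (Λ : WithLp 2 (X × ℝ) →L[ℝ] ℝ) :
    ∃ (φ : X →L[ℝ] ℝ) (s : ℝ), ∀ p, Λ p = φ p.fst + s * p.snd := by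
  refine ⟨Λ.comp ((WithLp.prodContinuousLinearEquiv 2 ℝ X ℝ).symm.toContinuousLinearMap.comp
    (ContinuousLinearMap.inl ℝ X ℝ)), Λ (WithLp.toLp 2 (0, 1)), fun p => ?_⟩
  have hp : p = WithLp.toLp 2 (p.fst, 0) + p.snd • WithLp.toLp 2 ((0 : X), (1 : ℝ)) := by
    apply (WithLp.prodContinuousLinearEquiv 2 ℝ X ℝ).injective
    ext <;> simp
  conv_lhs => rw [hp, map_add, map_smul, smul_eq_mul, mul_comm]
  rfl

/-- Superlinear growth makes the epigraph coercive; boundedness below on bounded sets comes from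
an affine minorant. -/
theorem IsConvexLsc.coercive_epi {f : X → EReal} (hf : IsConvexLsc f)
    (hgrowth : Tendsto (fun x : X => f x / ((‖x‖ : ℝ) : EReal)) (Bornology.cobounded X) (𝓝 ⊤)) :
    Coercive (epi f) := by
  intro K
  rcases (epi f).eq_empty_or_nonempty with hemp | ⟨p₀, hp₀⟩
  · exact ⟨0, by simp [hemp]⟩
  obtain ⟨t₁, ht₁⟩ : ∃ t : ℝ, (t : EReal) < f p₀.fst := by
    by_contra! h
    exact hf.ne_bot _ (EReal.eq_bot_iff_forall_lt _ |>.2 fun y =>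
      (h (y - 1)).trans_lt (EReal.coe_lt_coe_iff.2 (by linarith)))
  have hnot : WithLp.toLp 2 (p₀.fst, t₁) ∉ epi f := fun h => not_le_of_gt ht₁ h
  have ht : t₁ < p₀.snd := EReal.coe_lt_coe_iff.1 (ht₁.trans_le hp₀)
  obtain ⟨Λ, u, hΛ, hu⟩ := geometric_hahn_banach_point_closed hf.convex_epi hf.isClosed_epi hnot
  obtain ⟨φ, s, hs⟩ := exists_split Λ
  have hs0 : 0 < s := by
    have h := hΛ.trans (hu p₀ hp₀)
    rw [hs, hs] at h
    simp only [WithLp.toLp_fst, WithLp.toLp_snd] at h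
    have : 0 < s * (p₀.snd - t₁) := by linarith
    exact pos_of_mul_pos_left this (by linarith)
  have hev : ∀ᶠ x in Bornology.cobounded X, (K : EReal) < f x / ((‖x‖ : ℝ) : EReal) :=
    EReal.tendsto_nhds_top_iff_real.1 hgrowth K
  obtain ⟨R, -, hR⟩ := hasBasis_cobounded_norm.eventually_iff.1 hev
  set R' := max R 1 with hR'
  have hR'pos : 0 < R' := lt_of_lt_of_le one_pos (le_max_right _ _)
  set C := |K| * R' + (‖φ‖ * R' + |u|) / s with hC
  have hC0 : 0 ≤ C := by positivity
  refine ⟨C, fun p hp => ?_⟩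
  rcases le_or_gt R' ‖p.fst‖ with h | h
  · have hpos : 0 < ‖p.fst‖ := hR'pos.trans_le h
    have h1 := hR (show R ≤ ‖p.fst‖ from (le_max_left _ _).trans h)
    rw [EReal.lt_div_iff (EReal.coe_pos.2 hpos) (EReal.coe_ne_top _), ← EReal.coe_mul] at h1
    have h2 := EReal.coe_lt_coe_iff.1 (h1.trans_le hp)
    linarith
  · have h1 := hu p hp
    rw [hs] at h1
    have h2 := (abs_le.1 (φ.le_opNorm p.fst)).2
    have h3 : ‖φ‖ * ‖p.fst‖ ≤ ‖φ‖ * R' := mul_le_mul_of_nonneg_left h.le (norm_nonneg _)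
    have h4 := neg_abs_le u
    have h5 : -((‖φ‖ * R' + |u|) / s) ≤ p.snd := by
      rw [← neg_div, div_le_iff₀ hs0]
      linarith
    have h6 : K * ‖p.fst‖ ≤ |K| * R' :=
      (mul_le_mul_of_nonneg_right (le_abs_self K) (norm_nonneg _)).trans
        (mul_le_mul_of_nonneg_left h.le (abs_nonneg _))
    linarith

/-- If the level sets of a coercive `f` are weakly compact, every tilt attains its minimum over the
epigraph: the sublevel sets of `f + ψ` are weakly closed subsets of a level set of `f`. -/
theorem HasWeaklyCompactLevelSets.nearMin_zero_nonempty {f : X → EReal}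
    (hwc : HasWeaklyCompactLevelSets f) (hf : IsConvexLsc f) (hE : Coercive (epi f))
    (hne : (epi f).Nonempty) (ψ : X →L[ℝ] ℝ) : (nearMin (epi f) ψ 0).Nonempty := by
  obtain ⟨m₀, hm₀⟩ := hE.exists_le_tilt ψ
  set m := sInf (tilt ψ '' epi f) with hm
  have hbdd : BddBelow (tilt ψ '' epi f) := ⟨m₀, by rintro _ ⟨a, ha, rfl⟩; exact hm₀ a ha⟩
  have hmle : ∀ q ∈ epi f, m ≤ tilt ψ q := fun q hq => csInf_le hbdd (mem_image_of_mem _ hq)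
  have hcont : ∀ δ : ℝ, Continuous fun x : X => WithLp.toLp 2 (x, m + δ - ψ x) := fun δ => by
    fun_prop
  let L : ℕ → Set X := fun n => {x | WithLp.toLp 2 (x, m + 1 / ((n : ℝ) + 1) - ψ x) ∈ epi f}
  have hLclosed : ∀ n, IsClosed (L n) := fun n => hf.isClosed_epi.preimage (hcont _)
  have hLconv : ∀ n, Convex ℝ (L n) := by
    intro n x hx y hy a b ha hb hab
    have := hf.convex_epi hx hy ha hb hab
    change WithLp.toLp 2 _ ∈ epi f
    convert this using 1
    rw [← WithLp.toLp_smul, ← WithLp.toLp_smul, ← WithLp.toLp_add, Prod.smul_mk, Prod.smul_mk,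
      Prod.mk_add_mk, map_add, map_smul, map_smul, smul_eq_mul, smul_eq_mul, smul_eq_mul,
      smul_eq_mul]
    obtain rfl : b = 1 - a := by linarith
    congr 2
    ring
  have hLw : ∀ n, IsClosed (toWeakSpace ℝ X '' L n) := by
    intro n
    have := (hLconv n).toWeakSpace_closure ℝ
    rw [(hLclosed n).closure_eq] at this
    rw [this]
    exact isClosed_closure
  have hLanti : ∀ n, L (n + 1) ⊆ L n := by
    intro n x hx
    refine mem_epi_of_le (t := m + 1 / ((n : ℝ) + 1) - ψ x) hx ?_
    have := Nat.one_div_le_one_div (α := ℝ) (Nat.le_succ n)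
    simp only [WithLp.toLp_snd]
    push_cast at this ⊢
    linarith
  have hLne : ∀ n, (L n).Nonempty := by
    intro n
    have hpos : (0 : ℝ) < 1 / ((n : ℝ) + 1) := by positivity
    obtain ⟨_, ⟨q, hq, rfl⟩, hlt⟩ :=
      exists_lt_of_csInf_lt (hne.image (tilt ψ)) (lt_add_of_pos_right m hpos)
    exact ⟨q.fst, mem_epi_of_le hq (by simp only [tilt] at hlt; linarith)⟩
  obtain ⟨R, hR, hbd⟩ := hE.exists_norm_fst_le hne ‖ψ‖
  have hL0 : L 0 ⊆ {x : X | f x ≤ ((m + 1 + ‖ψ‖ * R : ℝ) : EReal)} := by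
    intro x hx
    have h1 : WithLp.toLp 2 (x, m + 1 / (((0 : ℕ) : ℝ) + 1) - ψ x) ∈ nearMin (epi f) ψ 1 := by
      refine ⟨hx, fun q hq => ?_⟩
      have := hmle q hq
      simp only [tilt, WithLp.toLp_snd, WithLp.toLp_fst] at this ⊢
      norm_num
      linarith
    have h2 : ‖x‖ ≤ R := hbd ψ le_rfl _ h1
    have h3 := (abs_le.1 (ψ.le_opNorm x)).1
    have h4 := mul_le_mul_of_nonneg_left h2 (norm_nonneg ψ)
    refine le_trans (show f x ≤ ((m + 1 / (((0 : ℕ) : ℝ) + 1) - ψ x : ℝ) : EReal) from hx)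
      (EReal.coe_le_coe_iff.2 ?_)
    norm_num
    linarith
  obtain ⟨z, hz⟩ := IsCompact.nonempty_iInter_of_sequence_nonempty_isCompact_isClosed
    (fun n => toWeakSpace ℝ X '' L n) (fun n => image_mono (hLanti n)) (fun n => (hLne n).image _)
    ((hwc _).of_isClosed_subset (hLw 0) (image_mono hL0)) hLw
  rw [mem_iInter] at hz
  obtain ⟨x, -, rfl⟩ := hz 0
  have hx : ∀ n, x ∈ L n := by
    intro n
    obtain ⟨y, hy, hyx⟩ := hz n
    rwa [← (toWeakSpace ℝ X).injective hyx]
  have hlim : Tendsto (fun n : ℕ => WithLp.toLp 2 (x, m + 1 / ((n : ℝ) + 1) - ψ x)) atTop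
      (𝓝 (WithLp.toLp 2 (x, m + 0 - ψ x))) := by
    have hc : Continuous fun δ : ℝ => WithLp.toLp 2 (x, m + δ - ψ x) := by fun_prop
    exact (hc.tendsto 0).comp (tendsto_one_div_add_atTop_nhds_zero_nat (𝕜 := ℝ))
  refine ⟨_, hf.isClosed_epi.mem_of_tendsto hlim (Eventually.of_forall hx), fun q hq => ?_⟩
  have := hmle q hq
  simp only [tilt, WithLp.toLp_snd, WithLp.toLp_fst] at this ⊢
  linarith

/-! ### The Bishop–Phelps theorem -/

/-- The closed unit ball of `X`, placed at height `0` in `X × ℝ`; tilts attain their minimum over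
it exactly when the functional attains its norm. -/
def flatBall (X : Type*) [NormedAddCommGroup X] : Set (WithLp 2 (X × ℝ)) :=
  {p | ‖p.fst‖ ≤ 1 ∧ p.snd = 0}

theorem isClosed_flatBall {X : Type*} [NormedAddCommGroup X] : IsClosed (flatBall X) := by
  have h1 : IsClosed {p : WithLp 2 (X × ℝ) | ‖p.fst‖ ≤ 1} :=
    isClosed_le (by fun_prop) continuous_const
  have h2 : IsClosed {p : WithLp 2 (X × ℝ) | p.snd = 0} :=
    isClosed_eq (by fun_prop) continuous_const
  exact h1.inter h2

theorem convex_flatBall : Convex ℝ (flatBall X) := by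
  rintro p ⟨hp, hp'⟩ q ⟨hq, hq'⟩ a b ha hb hab
  refine ⟨?_, by simp [hp', hq']⟩
  rw [WithLp.add_fst, WithLp.smul_fst, WithLp.smul_fst]
  rw [← mem_closedBall_zero_iff] at hp hq ⊢
  exact convex_closedBall _ _ hp hq ha hb hab

theorem zero_mem_flatBall {X : Type*} [NormedAddCommGroup X] :
    (0 : WithLp 2 (X × ℝ)) ∈ flatBall X := by simp [flatBall]

theorem coercive_flatBall {X : Type*} [NormedAddCommGroup X] : Coercive (flatBall X) := by
  refine fun K => ⟨|K|, fun p hp => ?_⟩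
  rw [hp.2]
  have := mul_le_mul (le_abs_self K) hp.1 (norm_nonneg _) (abs_nonneg _)
  linarith

theorem exists_norm_attained {ψ : X →L[ℝ] ℝ} (h : (nearMin (flatBall X) ψ 0).Nonempty) :
    ∃ u : X, ‖u‖ ≤ 1 ∧ ψ u = ‖ψ‖ := by
  obtain ⟨p, hp, hmin⟩ := h
  have hle : ∀ x : X, ‖x‖ ≤ 1 → -ψ x ≤ ψ (-p.fst) := by
    intro x hx
    have := hmin (WithLp.toLp 2 (x, 0)) ⟨hx, rfl⟩
    simp only [tilt, hp.2, WithLp.toLp_fst, WithLp.toLp_snd] at this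
    rw [map_neg]; linarith
  refine ⟨-p.fst, by rw [norm_neg]; exact hp.1, le_antisymm ?_ ?_⟩
  · have h1 := (abs_le.1 (ψ.le_opNorm (-p.fst))).2
    rw [norm_neg] at h1
    have h2 := mul_le_mul_of_nonneg_left hp.1 (norm_nonneg ψ)
    linarith
  · refine ψ.opNorm_le_of_unit_norm ?_ fun x hx => abs_le.2 ⟨?_, ?_⟩
    · simpa using hle 0 (by simp)
    · linarith [hle x hx.le]
    · have := hle (-x) (by rw [norm_neg]; exact hx.le)
      rwa [map_neg, neg_neg] at this

/-- The Bishop–Phelps theorem, for the unit ball. -/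
theorem dense_norm_attaining [CompleteSpace X] :
    Dense {ψ : X →L[ℝ] ℝ | (nearMin (flatBall X) ψ 0).Nonempty} := by
  rw [Metric.dense_iff]
  intro ψ ρ hρ
  have hρ2 : 0 < ρ / 2 := by positivity
  obtain ⟨p, hp⟩ := coercive_flatBall.nearMin_nonempty ⟨0, zero_mem_flatBall⟩ ψ (mul_pos hρ2 hρ2)
  obtain ⟨ψ', hψ', p', hp', -⟩ := exists_nearMin_zero isClosed_flatBall convex_flatBall ψ hρ2 hp
  exact ⟨ψ', by rw [mem_ball_iff_norm]; linarith, p', hp'⟩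

/-! ### Wijsman convergence and slice convergence -/

theorem gap_singleton {Y : Type*} [PseudoEMetricSpace Y] (y : Y) (C : Set Y) :
    gap {y} C = Metric.infEDist y C := by
  simp [gap, Metric.infEDist]

/-- Wijsman convergence controls, on bounded sets, a functional `Λ` that attains its minimum over
the limit set at `c` and its norm at a point `v` where the norm is differentiable. Indeed `c` is
then the nearest point to `c - v`, and points `z` of `C i` with `Λ z` too small would, moved by
convexity close to `c`, come closer to `c - v` than the limit set does. -/
theorem ConvergesWijsman.eventually_sub_le {Y ι : Type*} [NormedAddCommGroup Y] [NormedSpace ℝ Y]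
    {l : Filter ι} {C : ι → Set Y} {D : Set Y} (hW : ConvergesWijsman l C D)
    (hC : ∀ i, Convex ℝ (C i)) {Λ : Y →L[ℝ] ℝ} {c : Y} (hc : c ∈ D) (hmin : ∀ d ∈ D, Λ c ≤ Λ d)
    {N : ℝ} (hN : 0 < N) (hle : ∀ y, Λ y ≤ N * ‖y‖) {v : Y} (hv : Λ v = N * ‖v‖)
    (hdiff : DifferentiableAt ℝ (fun y : Y => ‖y‖) v) (M : ℝ) {ε : ℝ} (hε : 0 < ε) :
    ∀ᶠ i in l, ∀ z ∈ C i, ‖z‖ ≤ M → Λ c - ε ≤ Λ z := by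
  obtain ⟨N', hN'⟩ := hdiff
  have hlocal : IsLocalMin (fun y => N * ‖y‖ - Λ y) v :=
    Eventually.of_forall fun y => by
      change N * ‖v‖ - Λ v ≤ N * ‖y‖ - Λ y
      linarith [hle y]
  -- Hence the derivative of the norm at `v` is `N⁻¹ Λ`.
  have hder := hlocal.hasFDerivAt_eq_zero ((hN'.const_mul N).sub Λ.hasFDerivAt)
  have hΛ : ∀ h, Λ h = N * N' h := fun h => by
    have := DFunLike.congr_fun hder h
    simp only [sub_apply, smul_apply, smul_eq_mul, zero_apply] at this
    linarith
  set B := |M| + ‖c‖ + 1 with hB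
  have hBpos : 0 < B := by positivity
  set κ := ε / (2 * N * B) with hκ
  have hκpos : 0 < κ := by positivity
  obtain ⟨ρ, hρ, hρb⟩ := Metric.eventually_nhds_iff.1
    ((hasFDerivAt_iff_isLittleO_nhds_zero.1 hN').bound hκpos)
  set s := min 1 (ρ / (2 * B)) with hs
  have hspos : 0 < s := by positivity
  have hs1 : s ≤ 1 := min_le_left _ _
  have hsB : s * B < ρ := by
    have : s * B ≤ ρ / (2 * B) * B := mul_le_mul_of_nonneg_right (min_le_right _ _) hBpos.le
    rw [div_mul_eq_mul_div, mul_div_mul_right _ _ hBpos.ne'] at this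
    linarith
  set β := s * ε / (4 * N) with hβ
  have hβpos : 0 < β := by positivity
  have hgc : ∀ᶠ i in l, Metric.infEDist c (C i) < ENNReal.ofReal β := by
    have := hW c
    simp only [gap_singleton, Metric.infEDist_zero_of_mem hc] at this
    exact this.eventually_lt_const (ENNReal.ofReal_pos.2 hβpos)
  -- The distance from `c - v` to `D` is at least `‖v‖`.
  have hgv : ∀ᶠ i in l, ∀ y ∈ C i, ‖v‖ - β < ‖y - (c - v)‖ := by
    rcases lt_or_ge (‖v‖ - β) 0 with hneg | hnn
    · exact Eventually.of_forall fun i y _ => hneg.trans_le (norm_nonneg _)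
    have h1 : ENNReal.ofReal ‖v‖ ≤ Metric.infEDist (c - v) D := by
      refine Metric.le_infEDist.2 fun d hd => ?_
      rw [edist_dist, dist_comm, dist_eq_norm]
      refine ENNReal.ofReal_le_ofReal (le_of_mul_le_mul_left ?_ hN)
      have h2 := hle (d - (c - v))
      rw [map_sub, map_sub] at h2
      linarith [hmin d hd]
    have h3 := hW (c - v)
    simp only [gap_singleton] at h3
    have h4 : ENNReal.ofReal (‖v‖ - β) < Metric.infEDist (c - v) D :=
      lt_of_lt_of_le ((ENNReal.ofReal_lt_ofReal_iff (by linarith)).2 (by linarith)) h1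
    filter_upwards [h3.eventually_const_lt h4] with i hi y hy
    have h5 := hi.trans_le (Metric.infEDist_le_edist_of_mem hy)
    rw [edist_dist, dist_comm, dist_eq_norm] at h5
    exact (ENNReal.ofReal_lt_ofReal_iff_of_nonneg hnn).1 h5
  filter_upwards [hgc, hgv] with i hi hi' z hz hzM
  by_contra! hlt
  obtain ⟨w, hw, hwc⟩ := Metric.infEDist_lt_iff.1 hi
  rw [edist_dist, dist_comm, dist_eq_norm, ENNReal.ofReal_lt_ofReal_iff hβpos] at hwc
  have hmem : (1 - s) • w + s • z ∈ C i := hC i hw hz (by linarith) hspos.le (by ring)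
  have h1 := hi' _ hmem
  have hsplit : (1 - s) • w + s • z - (c - v) = (1 - s) • (w - c) + (v + s • (z - c)) := by module
  have h2 : ‖(1 - s) • (w - c)‖ ≤ β := by
    rw [norm_smul, Real.norm_of_nonneg (by linarith)]
    nlinarith [norm_nonneg (w - c)]
  have hzc : ‖z - c‖ ≤ B := (norm_sub_le _ _).trans (by rw [hB]; linarith [le_abs_self M])
  have hszc : ‖s • (z - c)‖ ≤ s * B := by
    rw [norm_smul, Real.norm_of_nonneg hspos.le]
    exact mul_le_mul_of_nonneg_left hzc hspos.le
  have h3 := hρb (y := s • (z - c)) (by rw [dist_zero_right]; linarith)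
  have h4 := (abs_le.1 h3).2
  have h5 : N' (s • (z - c)) ≤ -(s * ε / N) := by
    have h6 := hΛ (s • (z - c))
    rw [map_smul, smul_eq_mul, map_sub] at h6
    refine le_of_mul_le_mul_left ?_ hN
    rw [← h6, mul_neg, mul_div_cancel₀ _ hN.ne']
    nlinarith
  have h6 : κ * ‖s • (z - c)‖ ≤ s * ε / (2 * N) := by
    refine (mul_le_mul_of_nonneg_left hszc hκpos.le).trans (le_of_eq ?_)
    rw [hκ]; field_simp
  rw [hsplit] at h1
  have h7 := norm_add_le ((1 - s) • (w - c)) (v + s • (z - c))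
  have h8 : s * ε / N = 4 * β := by rw [hβ]; field_simp
  have h9 : s * ε / (2 * N) = 2 * β := by rw [hβ]; field_simp; norm_num
  linarith

/-- Away from `X × {0}` the `ℓ₂` product norm is differentiable, since `‖x‖²` is differentiable
everywhere, including the origin. -/
theorem FrechetDifferentiableNorm.differentiableAt_prod (hX : FrechetDifferentiableNorm X)
    {v : WithLp 2 (X × ℝ)} (hv : v.snd ≠ 0) :
    DifferentiableAt ℝ (fun y : WithLp 2 (X × ℝ) => ‖y‖) v := by
  have hsq : ∀ x : X, DifferentiableAt ℝ (fun y : X => ‖y‖ ^ 2) x := by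
    intro x
    rcases eq_or_ne x 0 with rfl | hx
    · refine ⟨0, hasFDerivAt_iff_isLittleO_nhds_zero.2 ?_⟩
      simpa using Asymptotics.isLittleO_norm_pow_id (E' := X) one_lt_two
    · exact (hX x hx).pow 2
  simp only [WithLp.prod_norm_eq_of_L2, Real.norm_eq_abs, sq_abs]
  refine DifferentiableAt.sqrt (DifferentiableAt.add ?_ ?_) (by positivity)
  · exact (hsq v.fst).comp v (WithLp.fstL 2 ℝ X ℝ).differentiableAt
  · exact ((WithLp.sndL 2 ℝ X ℝ).differentiableAt (x := v)).pow 2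

theorem tilt_le_sqrt_mul_norm (ψ : X →L[ℝ] ℝ) (y : WithLp 2 (X × ℝ)) :
    tilt ψ y ≤ √(‖ψ‖ ^ 2 + 1) * ‖y‖ := by
  rw [WithLp.prod_norm_eq_of_L2, ← Real.sqrt_mul (by positivity), Real.norm_eq_abs, sq_abs]
  have h1 := (abs_le.1 (ψ.le_opNorm y.fst)).2
  refine le_trans (show tilt ψ y ≤ y.snd + ‖ψ‖ * ‖y.fst‖ by simp only [tilt]; linarith)
    (Real.le_sqrt_of_sq_le ?_)
  nlinarith [sq_nonneg (‖ψ‖ * y.snd - ‖y.fst‖)]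

theorem tilt_eq_sqrt_mul_norm {ψ : X →L[ℝ] ℝ} {u : X} (hu : ‖u‖ ≤ 1) (hψu : ψ u = ‖ψ‖) :
    tilt ψ (WithLp.toLp 2 (‖ψ‖ • u, 1)) =
      √(‖ψ‖ ^ 2 + 1) * ‖(WithLp.toLp 2 (‖ψ‖ • u, 1) : WithLp 2 (X × ℝ))‖ := by
  have h1 : ‖ψ‖ * ‖u‖ = ‖ψ‖ := by
    refine le_antisymm (mul_le_of_le_one_right (norm_nonneg _) hu) ?_
    have := (abs_le.1 (ψ.le_opNorm u)).2
    rwa [hψu] at this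
  rw [WithLp.prod_norm_eq_of_L2]
  simp only [tilt, WithLp.toLp_fst, WithLp.toLp_snd, map_smul, smul_eq_mul, hψu, norm_smul,
    norm_norm, h1, norm_one, one_pow]
  rw [Real.mul_self_sqrt (by positivity)]
  ring

/-- Convex sets at distance at least `r` are separated by a functional `Λ` with a gap `r ‖Λ‖`. -/
theorem exists_separating {Y : Type*} [NormedAddCommGroup Y] [NormedSpace ℝ Y] {W C : Set Y}
    (hW : Convex ℝ W) (hC : Convex ℝ C) (hWne : W.Nonempty) (hCne : C.Nonempty) {r : ℝ}
    (hr : 0 < r) (hdist : ∀ w ∈ W, ∀ c ∈ C, r ≤ dist w c) :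
    ∃ (Λ : Y →L[ℝ] ℝ) (u : ℝ), 0 < ‖Λ‖ ∧ (∀ w ∈ W, Λ w + r * ‖Λ‖ ≤ u) ∧ ∀ c ∈ C, u ≤ Λ c := by
  have hdisj : Disjoint (Metric.thickening r W) C := by
    rw [Set.disjoint_left]
    intro z hz hzC
    obtain ⟨w, hw, hlt⟩ := Metric.mem_thickening_iff.1 hz
    rw [dist_comm] at hlt
    exact absurd (hdist w hw z hzC) (not_le_of_gt hlt)
  obtain ⟨Λ, u, hΛ, hu⟩ := geometric_hahn_banach_open (hW.thickening r) Metric.isOpen_thickening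
    hC hdisj
  obtain ⟨w₀, hw₀⟩ := hWne
  obtain ⟨c₀, hc₀⟩ := hCne
  have hlt : ∀ w ∈ W, Λ w < u := fun w hw => hΛ w (Metric.self_subset_thickening hr W hw)
  refine ⟨Λ, u, norm_pos_iff.2 ?_, fun w hw => ?_, hu⟩
  · rintro rfl
    have := (hlt w₀ hw₀).trans_le (hu c₀ hc₀)
    simp at this
  · have hpos : 0 < u - Λ w := sub_pos.2 (hlt w hw)
    have hle : ∀ x : Y, ‖x‖ = 1 → Λ x ≤ (u - Λ w) / r := by
      intro x hx
      by_contra! h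
      have hΛx : 0 < Λ x := (div_pos hpos hr).trans h
      -- The point `w + t x` of the thickening would lie on the separating hyperplane.
      set t := (u - Λ w) / Λ x with ht
      have htr : t < r := by
        rw [ht, div_lt_iff₀ hΛx]
        rw [div_lt_iff₀ hr] at h
        linarith
      have htpos : 0 < t := div_pos hpos hΛx
      have hmem : w + t • x ∈ Metric.thickening r W := by
        refine Metric.mem_thickening_iff.2 ⟨w, hw, ?_⟩
        rw [dist_eq_norm, add_sub_cancel_left, norm_smul, hx, mul_one,
          Real.norm_of_nonneg htpos.le]
        exact htr
      have := hΛ _ hmem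
      rw [map_add, map_smul, smul_eq_mul, ht, div_mul_cancel₀ _ hΛx.ne'] at this
      linarith
    have hnorm : ‖Λ‖ ≤ (u - Λ w) / r := by
      refine Λ.opNorm_le_of_unit_norm (div_pos hpos hr).le fun x hx => abs_le.2 ⟨?_, hle x hx⟩
      have := hle (-x) (by rwa [norm_neg])
      rw [map_neg] at this
      linarith
    rw [le_div_iff₀ hr] at hnorm
    linarith

/-- Slice convergence follows from Wijsman convergence once densely many functionals attain both
their norm and their minimum over the limit set. A functional strictly separating `W` from the
limit is replaced by a nearby multiple of such a tilt; coercivity keeps its infimum over the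
limit under control. -/
theorem ConvergesWijsman.convergesSlice {ι : Type*} {l : Filter ι} {C : ι → Set (WithLp 2 (X × ℝ))}
    {E : Set (WithLp 2 (X × ℝ))} (hX : FrechetDifferentiableNorm X)
    (hW : ConvergesWijsman l C E) (hC : ∀ i, Convex ℝ (C i)) (hconv : Convex ℝ E)
    (hE : Coercive E) (hup : ∀ p ∈ E, ∀ t : ℝ, p.snd ≤ t → WithLp.toLp 2 (p.fst, t) ∈ E)
    (hdense : E.Nonempty → Dense
      {ψ : X →L[ℝ] ℝ | (nearMin E ψ 0).Nonempty ∧ (nearMin (flatBall X) ψ 0).Nonempty}) :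
    ConvergesSlice l C E := by
  intro W _ hWbd hWconv
  rw [tendsto_order]
  constructor
  swap
  · intro b hb
    obtain ⟨w, hw, hlt⟩ : ∃ w ∈ W, Metric.infEDist w E < b := by
      have hb' : ⨅ w ∈ W, Metric.infEDist w E < b := hb
      simpa only [iInf_lt_iff, exists_prop] using hb'
    have := hW w
    simp only [gap_singleton] at this
    filter_upwards [this.eventually_lt_const hlt] with i hi
    exact (iInf₂_le w hw).trans_lt hi
  intro a ha
  obtain ⟨r, har, hr⟩ := ENNReal.lt_iff_exists_nnreal_btwn.1 ha
  obtain ⟨r', hrr', hr'⟩ := ENNReal.lt_iff_exists_nnreal_btwn.1 hr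
  have hrr : (r : ℝ) < r' := by exact_mod_cast hrr'
  suffices h : ∀ᶠ i in l, ∀ w ∈ W, ∀ z ∈ C i, (r : ℝ) ≤ dist w z by
    filter_upwards [h] with i hi
    refine har.trans_le (le_iInf₂ fun w hw => le_iInf₂ fun z hz => ?_)
    rw [edist_nndist, ENNReal.coe_le_coe, ← NNReal.coe_le_coe, coe_nndist]
    exact hi w hw z hz
  rcases W.eq_empty_or_nonempty with rfl | hWne
  · simp
  obtain ⟨M, hMpos, hM⟩ := hWbd.exists_pos_norm_le
  rcases E.eq_empty_or_nonempty with rfl | hEne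
  · obtain ⟨w₀, hw₀⟩ := hWne
    have h1 := hW w₀
    simp only [gap_singleton, Metric.infEDist_empty] at h1
    filter_upwards [h1.eventually_const_lt (ENNReal.ofReal_lt_top (r := r + 2 * M))]
      with i hi w hw z hz
    have h2 := hi.trans_le (Metric.infEDist_le_edist_of_mem hz)
    rw [edist_dist, ENNReal.ofReal_lt_ofReal_iff_of_nonneg (by positivity)] at h2
    have h3 := dist_triangle w₀ w z
    have h4 : dist w₀ w ≤ 2 * M := by
      rw [dist_eq_norm]
      linarith [norm_sub_le w₀ w, hM w₀ hw₀, hM w hw]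
    linarith
  have hdist : ∀ w ∈ W, ∀ c ∈ E, (r' : ℝ) ≤ dist w c := by
    intro w hw c hc
    have h1 := hr'.le.trans ((iInf₂_le w hw).trans (iInf₂_le c hc))
    rwa [edist_nndist, ENNReal.coe_le_coe, ← NNReal.coe_le_coe, coe_nndist] at h1
  obtain ⟨Λ, u, hΛpos, hΛW, hΛE⟩ := exists_separating hWconv hconv hWne hEne
    (lt_of_le_of_lt r.coe_nonneg hrr) hdist
  obtain ⟨φ, s, hs⟩ := exists_split Λ
  -- `E` contains vertical half-lines, on which `Λ` is bounded below.
  have hs0 : 0 ≤ s := by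
    by_contra! hneg
    obtain ⟨c, hc⟩ := hEne
    have hstep : 0 ≤ (Λ c - u + 1) / -s :=
      div_nonneg (by linarith [hΛE c hc]) (by linarith)
    have h1 := hΛE _ (hup c hc (c.snd + (Λ c - u + 1) / -s) (by linarith))
    have h2 : s * ((Λ c - u + 1) / -s) = -(Λ c - u + 1) := by
      rw [div_neg, mul_neg, mul_div_cancel₀ _ hneg.ne]
    have h3 := hs c
    rw [hs] at h1
    simp only [WithLp.toLp_fst, WithLp.toLp_snd, mul_add, h2] at h1
    linarith
  obtain ⟨K, hK⟩ := hE 1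
  set ε := (r' - r) * ‖Λ‖ / 4 with hε
  have hεpos : 0 < ε := by
    have : 0 < (r' : ℝ) - r := sub_pos.2 hrr
    positivity
  -- `s + η` replaces `s` as the slope in height, and `(s + η) ψ` will be `η`-close to `φ`. The gain
  -- `η t ≥ η (‖x‖ - K)` on `E` makes up for the loss `η ‖x‖`, whatever the size of `x`.
  set η := ε / (2 * (M + r + |K| + 1)) with hη
  have hdenpos : 0 < M + r + |K| + 1 := by positivity
  have hηpos : 0 < η := by positivity
  have hηε : 2 * η * (M + r + |K| + 1) = ε := by rw [hη]; field_simp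
  have hηK : η * K ≤ ε := by nlinarith [le_abs_self K, abs_nonneg K, r.coe_nonneg]
  have hηM : 2 * η * (M + r) ≤ ε := by nlinarith [abs_nonneg K]
  have hs' : 0 < s + η := by linarith
  obtain ⟨ψ, ⟨⟨c, hc⟩, hball⟩, hψ⟩ := Metric.dense_iff.1 (hdense hEne) ((s + η)⁻¹ • φ)
    (η / (s + η)) (by positivity) |>.imp fun _ h => h.symm
  obtain ⟨x₀, hx₀, hψx₀⟩ := exists_norm_attained hball
  have hclose : ∀ x, |(s + η) * ψ x - φ x| ≤ η * ‖x‖ := by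
    intro x
    have h1 := (ψ - (s + η)⁻¹ • φ).le_of_opNorm_le (mem_ball_iff_norm.1 hψ).le x
    have h2 : (s + η) * ψ x - φ x = (s + η) * (ψ - (s + η)⁻¹ • φ) x := by
      simp only [sub_apply, smul_apply, smul_eq_mul]
      field_simp
    rw [h2, abs_mul, abs_of_pos hs']
    refine (mul_le_mul_of_nonneg_left h1 hs'.le).trans (le_of_eq ?_)
    field_simp
  let Λ' : WithLp 2 (X × ℝ) →L[ℝ] ℝ :=
    (s + η) • (WithLp.sndL 2 ℝ X ℝ + ψ.comp (WithLp.fstL 2 ℝ X ℝ))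
  have hΛ' : ∀ y, Λ' y = (s + η) * tilt ψ y := fun y => rfl
  have hlow : u - ε ≤ Λ' c := by
    have h1 := hΛE c hc.1
    have h2 := hK c hc.1
    have h3 := (abs_le.1 (hclose c.fst)).1
    rw [hs] at h1
    rw [hΛ', tilt, mul_add, add_mul]
    nlinarith
  have hnear : ∀ y : WithLp 2 (X × ℝ), ‖y‖ ≤ M + r → Λ' y ≤ Λ y + ε := by
    intro y hy
    have h1 := (abs_le.1 (hclose y.fst)).2
    have h2 : ‖y.fst‖ ≤ M + r := (WithLp.norm_fst_le X y).trans hy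
    have h3 : y.snd ≤ M + r := (le_abs_self _).trans ((WithLp.norm_snd_le X y).trans hy)
    rw [hΛ', hs, tilt]
    nlinarith
  have hev := hW.eventually_sub_le hC (Λ := Λ') hc.1
    (fun d hd => by
      rw [hΛ', hΛ']
      exact mul_le_mul_of_nonneg_left (by linarith [hc.2 d hd]) hs'.le)
    (N := (s + η) * √(‖ψ‖ ^ 2 + 1)) (by positivity)
    (fun y => by
      rw [hΛ', mul_assoc]
      exact mul_le_mul_of_nonneg_left (tilt_le_sqrt_mul_norm ψ y) hs'.le)
    (v := WithLp.toLp 2 (‖ψ‖ • x₀, 1))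
    (by rw [hΛ', mul_assoc, tilt_eq_sqrt_mul_norm hx₀ hψx₀])
    (hX.differentiableAt_prod (by simp)) (M + r) hεpos
  filter_upwards [hev] with i hi w hw z hz
  by_contra! hlt
  rw [dist_comm, dist_eq_norm] at hlt
  have hzM : ‖z‖ ≤ M + r := by
    have := norm_le_norm_add_norm_sub w z
    rw [norm_sub_rev] at this
    linarith [hM w hw]
  have h1 := hi z hz hzM
  have h2 := hnear z hzM
  have h3 := hΛW w hw
  have h4 := (abs_le.1 (Λ.le_opNorm (z - w))).2
  rw [map_sub] at h4
  have h5 : ‖Λ‖ * ‖z - w‖ ≤ ‖Λ‖ * r := mul_le_mul_of_nonneg_left hlt.le hΛpos.le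
  have h6 : 4 * ε = r' * ‖Λ‖ - r * ‖Λ‖ := by rw [hε]; ring
  linarith

end SetConvergence

theorem theorem3p12 {X : Type*} [NormedAddCommGroup X] [NormedSpace ℝ X] [CompleteSpace X]
    (hX : SetConvergence.FrechetDifferentiableNorm X)
    (f : X → EReal) (hf : SetConvergence.IsConvexLsc f)
    (hgrowth : Filter.Tendsto (fun x : X => f x / ((‖x‖ : ℝ) : EReal))
      (Bornology.cobounded X) (nhds ⊤))
    {ι : Type*} (l : Filter ι) (F : ι → X → EReal)
    (hF : ∀ i, SetConvergence.IsConvexLsc (F i))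
    (hW : SetConvergence.ConvergesWijsman l (fun i => SetConvergence.epi (F i))
      (SetConvergence.epi f)) :
    (SetConvergence.HasRNP X →
      SetConvergence.ConvergesSlice l (fun i => SetConvergence.epi (F i))
        (SetConvergence.epi f)) ∧
    (SetConvergence.HasWeaklyCompactLevelSets f →
      SetConvergence.ConvergesSlice l (fun i => SetConvergence.epi (F i))
        (SetConvergence.epi f)) := by
  have hE := hf.coercive_epi hgrowth
  have hslice := hW.convergesSlice hX (fun i => (hF i).convex_epi) hf.convex_epi hE
    (fun p hp t ht => SetConvergence.mem_epi_of_le hp ht)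
  refine ⟨fun hRNP => hslice fun hne => ?_, fun hwc => hslice fun hne => ?_⟩
  · exact hRNP.dense_attain hf.isClosed_epi hf.convex_epi hE hne
      SetConvergence.isClosed_flatBall SetConvergence.convex_flatBall
      SetConvergence.coercive_flatBall ⟨0, SetConvergence.zero_mem_flatBall⟩
  · exact SetConvergence.dense_norm_attaining.mono fun ψ hψ =>
      ⟨hwc.nearMin_zero_nonempty hf hE hne ψ, hψ⟩
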